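/- For a finite alphabet $\Sigma$ (the usual case being $\Sigma=\{0,1\}$) and $n\ge 0$, let $f:\Sigma^n\to\{0,1,*\}$ be a partial boolean function with domain $\mathrm{dom} f=f^{-1}(\{0,1\})$. Let $\mathrm{R}(f)$ be its randomized query complexity: the least $q$ for which some probability distribution over deterministic decision trees of depth at most $q$ outputs $f(x)$ with probability at least $2/3$ on every $x\in\mathrm{dom} f$. For a probability distribution $\mathcal D$ on $\mathrm{dom} f$ and $k\ge1$, let $k\text{-}\mathrm{sel}(f,\mathcal D)$ be the least depth of a deterministic decision tree that queries individual letters of $x=(x^1,\dots,x^k)\sim\mathcal D^k$ ($k$ independent samples) and, with probability at least $2/3$ over $x$, outputs a pair $(i,b)\in\{1,\dots,k\}\times\{0,1\}$ with $f(x^i)=b$. Let $\mathrm{sel}(f,\mathcal D)=\min_{k\ge1}k\text{-}\mathrm{sel}(f,\mathcal D)$ and $\mathrm{sel}(f)=\max_{\mathcal D}\mathrm{sel}(f,\mathcal D)$, the maximum being over all probability distributions $\mathcal D$ on $\mathrm{dom} f$ (and $\mathrm{sel}(f)=0$ if $\mathrm{dom} f=\emptyset$). Then $\mathrm{sel}(f)=\Theta(\mathrm{R}(f))$: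 there are absolute constants $c,C>0$ such that, for all $\Sigma$, $n$ and $f$ as above, $$c\cdot\mathrm{R}(f)\;\le\;\mathrm{sel}(f)\;\le\;C\cdot\mathrm{R}(f).$$ The same holds, with the same constants, if the maximum in the definition of $\mathrm{sel}(f)$ is restricted to balanced distributions $\mathcal D=\frac12\mathcal D_0+\frac12\mathcal D_1$ with $\mathcal D_b$ a distribution on $f^{-1}(b)$ (the maximum being $0$ if there are none, i.e. if $f$ is constant on its domain). -/

import Mathlib

namespace QueryComplexity

/-- Deterministic decision trees on inputs `x : ι → α` (coordinates indexed by `ι`, letters in the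
alphabet `α`) with outputs in `β`. An inner vertex queries one coordinate and branches on the
answer. -/
inductive DecisionTree (ι α β : Type) : Type where
  | leaf (b : β) : DecisionTree ι α β
  | query (i : ι) (next : α → DecisionTree ι α β) : DecisionTree ι α β

namespace DecisionTree

/-- The output of the tree on input `x`. -/
def eval {ι α β : Type} : DecisionTree ι α β → (ι → α) → β
  | leaf b, _ => b
  | query i next, x => (next (x i)).eval x

/-- The largest number of queries on a root-to-leaf path. -/
def depth {ι α β : Type} [Fintype α] : DecisionTree ι α β → ℕ
  | leaf _ => 0
  | query _ next => 1 + Finset.univ.sup fun a => (next a).depth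

end DecisionTree

/-- A partial boolean function on `αⁿ`: `f x = none` means that `f` is undefined at `x`, while
`some false` and `some true` are the values `0` and `1`. -/
abbrev PartialFun (α : Type) (n : ℕ) : Type := (Fin n → α) → Option Bool

variable {α : Type} [Fintype α] {n : ℕ}

/-- There is a randomized decision tree (a probability distribution `p` on deterministic decision
trees `T r`) making at most `q` queries which, on every input `x` in the domain of `f`, outputs
`f x` with probability at least `1 - ε`. (There are only finitely many deterministic trees of depth
at most `q`, so finitely supported distributions suffice.) -/
def RandomizedComputes (ε : ℝ) (f : PartialFun α n) (q : ℕ) : Prop :=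
  ∃ (m : ℕ) (p : Fin m → ℝ) (T : Fin m → DecisionTree (Fin n) α Bool),
    p ∈ stdSimplex ℝ (Fin m) ∧ (∀ r, (T r).depth ≤ q) ∧
      ∀ x b, f x = some b → 1 - ε ≤ ∑ r with (T r).eval x = b, p r

/-- The randomized `ε`-error query complexity `R_ε(f)`. -/
noncomputable def randQuery (ε : ℝ) (f : PartialFun α n) : ℕ :=
  sInf {q | RandomizedComputes ε f q}

/-- `D` is a probability distribution on inputs of `f`: a probability mass function on `αⁿ`
supported on the domain of `f`. -/
def IsInputDist (f : PartialFun α n) (D : (Fin n → α) → ℝ) : Prop :=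
  D ∈ stdSimplex ℝ (Fin n → α) ∧ ∀ x, f x = none → D x = 0

/-- `D` is a balanced input distribution: `D = ½ D₀ + ½ D₁` with `D_b` a distribution on
`f⁻¹(b)`. -/
def IsBalancedDist (f : PartialFun α n) (D : (Fin n → α) → ℝ) : Prop :=
  IsInputDist f D ∧ ∀ b : Bool, ∑ x with f x = some b, D x = 1 / 2

/-- The probability, over `x = (x¹, …, xᵏ) ∼ Dᵏ`, that the output `(i, b)` of `T` on `x` satisfies
`f(xⁱ) = b`. The coordinate `(j, l)` is the `l`-th letter of the `j`-th sample. -/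
def selectionSuccess {k : ℕ} (f : PartialFun α n) (D : (Fin n → α) → ℝ)
    (T : DecisionTree (Fin k × Fin n) α (Fin k × Bool)) : ℝ :=
  ∑ x : Fin k → Fin n → α with
    f (x (T.eval fun c => x c.1 c.2).1) = some (T.eval fun c => x c.1 c.2).2, ∏ j, D (x j)

/-- `k`-selection for `(f, D)` can be solved with error at most `ε` using at most `q` queries. -/
def SelectionSolvable (ε : ℝ) (k : ℕ) (f : PartialFun α n) (D : (Fin n → α) → ℝ) (q : ℕ) : Prop :=
  ∃ T : DecisionTree (Fin k × Fin n) α (Fin k × Bool),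
    T.depth ≤ q ∧ 1 - ε ≤ selectionSuccess f D T

/-- `k-sel_ε(f, D)`: the `ε`-error query complexity of `k`-selection. -/
noncomputable def kSel (ε : ℝ) (k : ℕ) (f : PartialFun α n) (D : (Fin n → α) → ℝ) : ℕ :=
  sInf {q | SelectionSolvable ε k f D q}

/-- `sel_ε(f, D) = min_{k ≥ 1} k-sel_ε(f, D)`. -/
noncomputable def selDist (ε : ℝ) (f : PartialFun α n) (D : (Fin n → α) → ℝ) : ℕ :=
  sInf {q | ∃ k, 1 ≤ k ∧ kSel ε k f D = q}

/-- `sel_ε(f) = max_D sel_ε(f, D)`, over all distributions on inputs of `f`. -/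
noncomputable def sel (ε : ℝ) (f : PartialFun α n) : ℕ :=
  sSup {q | ∃ D, IsInputDist f D ∧ selDist ε f D = q}

/-- The variant of `sel_ε(f)` where the maximum is over balanced distributions only
(it is `0` if there are none, that is, if `f` is constant on its domain). -/
noncomputable def selBalanced (ε : ℝ) (f : PartialFun α n) : ℕ :=
  sSup {q | ∃ D, IsBalancedDist f D ∧ selDist ε f D = q}

/-! The minima and maxima above are over nonempty, respectively bounded, sets. -/

theorem DecisionTree.exists_eval_eq {ι β : Type} [Nonempty β] (s : Finset ι) :
    ∀ g : (ι → α) → β, (∀ x y, (∀ i ∈ s, x i = y i) → g x = g y) →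
      ∃ T : DecisionTree ι α β, T.depth ≤ s.card ∧ ∀ x, T.eval x = g x := by
  classical
  induction s using Finset.induction_on with
  | empty =>
    intro g hg
    by_cases h : Nonempty (ι → α)
    · obtain ⟨x₀⟩ := h
      exact ⟨leaf (g x₀), le_rfl, fun x => hg _ _ (by simp)⟩
    · exact ⟨leaf (Classical.arbitrary β), le_rfl, fun x => (h ⟨x⟩).elim⟩
  | insert i s his ih =>
    intro g hg
    have key : ∀ a : α, ∃ T : DecisionTree ι α β,
        T.depth ≤ s.card ∧ ∀ x, T.eval x = g (Function.update x i a) := by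
      intro a
      refine ih (fun x => g (Function.update x i a)) fun x y hxy => hg _ _ fun j hj => ?_
      by_cases hji : j = i
      · subst hji; simp
      · simp [hji, hxy j ((Finset.mem_insert.1 hj).resolve_left hji)]
    choose T hT hT' using key
    refine ⟨query i T, ?_, fun x => ?_⟩
    · rw [Finset.card_insert_of_notMem his, depth, add_comm]
      exact Nat.add_le_add_right (Finset.sup_le fun a _ => hT a) 1
    · rw [eval, hT', Function.update_eq_self]

theorem randomizedComputes_self {ε : ℝ} (hε : 0 ≤ ε) (f : PartialFun α n) :
    RandomizedComputes ε f n := by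
  obtain ⟨T, hT, hT'⟩ := DecisionTree.exists_eval_eq (α := α) (Finset.univ : Finset (Fin n))
    (fun x => (f x).getD false) fun x y h => by rw [funext fun i => h i (Finset.mem_univ i)]
  refine ⟨1, fun _ => 1, fun _ => T, ⟨by simp, by simp⟩, fun _ => by simpa using hT, ?_⟩
  intro x b hb
  simp [hT', hb, hε]

theorem selectionSolvable_self {ε : ℝ} (hε : 0 ≤ ε) {k : ℕ} (hk : 1 ≤ k) {f : PartialFun α n}
    {D : (Fin n → α) → ℝ} (hD : IsInputDist f D) : SelectionSolvable ε k f D n := by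
  classical
  have : Nonempty (Fin k × Bool) := ⟨(⟨0, hk⟩, false)⟩
  obtain ⟨T, hT, hT'⟩ := DecisionTree.exists_eval_eq (α := α)
    ((Finset.univ : Finset (Fin n)).image fun l => ((⟨0, hk⟩ : Fin k), l))
    (fun x => ((⟨0, hk⟩ : Fin k), (f fun l => x (⟨0, hk⟩, l)).getD false))
    fun x y h => by
      have : (fun l => x (⟨0, hk⟩, l)) = fun l => y (⟨0, hk⟩, l) :=
        funext fun l => h _ (Finset.mem_image_of_mem _ (Finset.mem_univ l))
      simp only [this]
  refine ⟨T, hT.trans (Finset.card_image_le.trans (by simp)), ?_⟩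
  have hone : selectionSuccess f D T = 1 := by
    unfold selectionSuccess
    rw [Finset.sum_filter_of_ne, ← Fintype.piFinset_univ, Finset.sum_prod_piFinset]
    · simp [hD.1.2]
    · intro x _ hx
      simp only [hT']
      have h0 : D (x ⟨0, hk⟩) ≠ 0 := (Finset.prod_ne_zero_iff.1 hx) _ (Finset.mem_univ _)
      cases hfx : f (x ⟨0, hk⟩) with
      | none => exact (h0 (hD.2 _ hfx)).elim
      | some b => rfl
  rw [hone]
  linarith

theorem selDist_le {ε : ℝ} (hε : 0 ≤ ε) {f : PartialFun α n} {D : (Fin n → α) → ℝ}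
    (hD : IsInputDist f D) : selDist ε f D ≤ n := by
  have h1 : kSel ε 1 f D ≤ n := Nat.sInf_le (selectionSolvable_self hε le_rfl hD)
  have h2 : selDist ε f D ≤ kSel ε 1 f D := Nat.sInf_le ⟨1, le_rfl, rfl⟩
  exact h2.trans h1

theorem bddAbove_sel {ε : ℝ} (hε : 0 ≤ ε) (f : PartialFun α n) :
    BddAbove {q | ∃ D, IsInputDist f D ∧ selDist ε f D = q} :=
  ⟨n, by rintro q ⟨D, hD, rfl⟩; exact selDist_le hε hD⟩

theorem bddAbove_selBalanced {ε : ℝ} (hε : 0 ≤ ε) (f : PartialFun α n) :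
    BddAbove {q | ∃ D, IsBalancedDist f D ∧ selDist ε f D = q} :=
  ⟨n, by rintro q ⟨D, hD, rfl⟩; exact selDist_le hε hD.1⟩

end QueryComplexity

/-! That `sel` is at most `randQuery` is averaging: some tree in the support of a randomized
algorithm succeeds on a single sample from `D`.

For the converse, consider trees of depth at most `q` with real labels `y`, `|y| ≤ 1/24`, scored by
`gain`: the correlation of `y` with the sign of `f`, minus `4 y²`, minus `2μ` per query, with `μ` of
order `1/q`. Separating a convex hull from the positive orthant leaves two cases.

(a) Some mixture of trees, with all labels shifted by a common `h`, has positive expected score on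
every input of the domain. Independent rounds are run and their shifted labels summed until `B`
queries are spent. The score condition makes `exp (∓ sum + μ · queries)` a supermartingale
(`sum_mul_exp_le_one`, `rounds_error_le`), so the sign of the sum is wrong with probability at most
`exp (-μB) ≤ exp (-2) < 1/3`.

(b) Some distribution, balanced because `h` is unconstrained, gives every tree nonpositive expected
score. Then selection is impossible with `q` queries, for any `k` (`not_selectionSolvable_of_gain`).
With the other samples fixed, a selector induces on sample `j` a tree labelled `±1/24` if `j` is
selected and `0` otherwise. Only one label is nonzero and the query counts add up to at most `q`, so
success probability `2/3` would give total expected score at least `1/144 - 2μq > 0`.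

For `q = selBalanced` case (b) is excluded, and (a) uses `B + q = 601 q` queries. -/

namespace QueryComplexity

variable {α : Type} {n : ℕ}

/-! ### Operations on decision trees: composition, restriction to one sample, repeated rounds -/

namespace DecisionTree

variable {ι β γ : Type}

/-- The number of queries made on input `x`. -/
def cost : DecisionTree ι α β → (ι → α) → ℕ
  | leaf _, _ => 0
  | query i next, x => 1 + (next (x i)).cost x

theorem cost_le_depth [Fintype α] (T : DecisionTree ι α β) (x : ι → α) : T.cost x ≤ T.depth := by
  induction T with
  | leaf b => exact le_rfl
  | query i next ih =>
    exact Nat.add_le_add_left ((ih (x i)).trans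
      (Finset.le_sup (f := fun a => (next a).depth) (Finset.mem_univ (x i)))) 1

/-- Relabel the coordinates along `g` and the outputs along `h`. -/
def relabel {ι' : Type} (g : ι → ι') (h : β → γ) :
    DecisionTree ι α β → DecisionTree ι' α γ
  | leaf b => leaf (h b)
  | query i next => query (g i) fun a => (next a).relabel g h

theorem eval_relabel {ι' : Type} (g : ι → ι') (h : β → γ) (T : DecisionTree ι α β)
    (x : ι' → α) : (T.relabel g h).eval x = h (T.eval (x ∘ g)) := by
  induction T with
  | leaf b => rfl
  | query i next ih => exact ih _

theorem depth_relabel [Fintype α] {ι' : Type} (g : ι → ι') (h : β → γ) (T : DecisionTree ι α β) :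
    (T.relabel g h).depth = T.depth := by
  induction T with
  | leaf b => rfl
  | query i next ih => simp [relabel, depth, ih]

/-- Run `T`, then the tree chosen by its output and by its number of queries, counted
from `c` on. -/
def bindCost : DecisionTree ι α β → ℕ → (β → ℕ → DecisionTree ι α γ) → DecisionTree ι α γ
  | leaf b, c, k => k b c
  | query i next, c, k => query i fun a => (next a).bindCost (c + 1) k

theorem eval_bindCost (T : DecisionTree ι α β) (c : ℕ) (k : β → ℕ → DecisionTree ι α γ)
    (x : ι → α) : (T.bindCost c k).eval x = (k (T.eval x) (c + T.cost x)).eval x := by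
  induction T generalizing c with
  | leaf b => rfl
  | query i next ih =>
    simp only [bindCost, eval, cost]
    rw [ih, add_assoc]

theorem depth_bindCost_add_le [Fintype α] (T : DecisionTree ι α β) (c M : ℕ)
    (k : β → ℕ → DecisionTree ι α γ) (hM : c + T.depth ≤ M)
    (hk : ∀ b d, d ≤ c + T.depth → (k b d).depth + d ≤ M) :
    (T.bindCost c k).depth + c ≤ M := by
  induction T generalizing c with
  | leaf b => exact hk b c (by simp)
  | query i next ih =>
    have hsup : ∀ a, (next a).depth ≤ Finset.univ.sup fun a => (next a).depth :=
      fun a => Finset.le_sup (f := fun a => (next a).depth) (Finset.mem_univ a)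
    simp only [depth] at hM hk
    have : (Finset.univ.sup fun a => ((next a).bindCost (c + 1) k).depth) ≤ M - (c + 1) := by
      refine Finset.sup_le fun a _ => Nat.le_sub_of_add_le ?_
      have := hsup a
      exact ih a (c + 1) (by omega) fun b d hd => hk b d (by omega)
    simp only [bindCost, depth]
    omega

/-- The tree induced by `T` on the `j`-th instance when the other instances are fixed by `x`. -/
def restrict {k n : ℕ} (j : Fin k) (x : Fin k → Fin n → α) :
    DecisionTree (Fin k × Fin n) α β → DecisionTree (Fin n) α β
  | leaf b => leaf b
  | query c next =>
    if c.1 = j then query c.2 fun a => (next a).restrict j x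
    else (next (x c.1 c.2)).restrict j x

/-- This independence allows averaging over the `j`-th sample with the others held fixed. -/
theorem restrict_congr {k n : ℕ} (j : Fin k) (x y : Fin k → Fin n → α)
    (h : ∀ i, i ≠ j → x i = y i) (T : DecisionTree (Fin k × Fin n) α β) :
    T.restrict j x = T.restrict j y := by
  induction T with
  | leaf b => rfl
  | query c next ih =>
    by_cases hc : c.1 = j
    · simp [restrict, hc, ih]
    · simp [restrict, hc, ih, h _ hc]

theorem eval_restrict {k n : ℕ} (j : Fin k) (x : Fin k → Fin n → α)
    (T : DecisionTree (Fin k × Fin n) α β) :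
    (T.restrict j x).eval (x j) = T.eval fun c => x c.1 c.2 := by
  induction T with
  | leaf b => rfl
  | query c next ih =>
    by_cases hc : c.1 = j
    · subst hc
      simp [restrict, eval, ih]
    · simp [restrict, eval, hc, ih]

/-- Each query is charged to the one sample it touches, so the total query penalty does not grow
with `k`. -/
theorem sum_cost_restrict {k n : ℕ} (x : Fin k → Fin n → α)
    (T : DecisionTree (Fin k × Fin n) α β) :
    ∑ j, (T.restrict j x).cost (x j) = T.cost fun c => x c.1 c.2 := by
  induction T with
  | leaf b => simp [restrict, cost]
  | query c next ih =>
    have : ∀ j, ((query c next).restrict j x).cost (x j) =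
        (if c.1 = j then 1 else 0) + ((next (x c.1 c.2)).restrict j x).cost (x j) := by
      intro j
      by_cases hc : c.1 = j
      · subst hc
        simp [restrict, cost]
      · simp [restrict, hc]
    simp only [this, Finset.sum_add_distrib, ih, cost]
    simp

theorem depth_restrict_le [Fintype α] {k n : ℕ} (j : Fin k) (x : Fin k → Fin n → α)
    (T : DecisionTree (Fin k × Fin n) α β) : (T.restrict j x).depth ≤ T.depth := by
  induction T with
  | leaf b => exact le_rfl
  | query c next ih =>
    have h : ∀ a, ((next a).restrict j x).depth ≤ Finset.univ.sup fun a => (next a).depth :=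
      fun a => (ih a).trans (Finset.le_sup (f := fun a => (next a).depth) (Finset.mem_univ a))
    by_cases hc : c.1 = j
    · simp only [restrict, hc, if_true, depth]
      exact Nat.add_le_add_left (Finset.sup_le fun a _ => h a) 1
    · simp only [restrict, hc, if_false, depth]
      exact (h _).trans (Nat.le_add_left _ _)

/-- Run labelled trees one after the other, adding up their labels, each shifted by `h`, until
`B` queries have been made or all trees have been run; output whether the sum is positive. -/
noncomputable def rounds {κ : Type} (B : ℕ) (h : ℝ) (T : κ → DecisionTree ι α ℝ) :
    (N : ℕ) → (Fin N → κ) → ℝ → ℕ → DecisionTree ι α Bool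
  | 0, _, s, _ => leaf (decide (0 < s))
  | N + 1, r, s, c =>
    if B ≤ c then leaf (decide (0 < s))
    else (T (r 0)).bindCost c fun y d => rounds B h T N (Fin.tail r) (s + y + h) d

/-- The budget is tested only between rounds, so the last round overshoots `B` by at most `q`. -/
theorem depth_rounds_add_le [Fintype α] {κ : Type} {B q : ℕ} {h : ℝ}
    {T : κ → DecisionTree ι α ℝ} (hT : ∀ r, (T r).depth ≤ q) (N : ℕ) (r : Fin N → κ)
    (s : ℝ) (c : ℕ) (hc : c ≤ B + q) : (rounds B h T N r s c).depth + c ≤ B + q := by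
  induction N generalizing s c with
  | zero => simpa [rounds, depth] using hc
  | succ N ih =>
    by_cases hB : B ≤ c
    · simpa [rounds, depth, hB] using hc
    · have := hT (r 0)
      simp only [rounds, hB, if_false]
      exact depth_bindCost_add_le _ _ _ _ (by omega) fun b d hd => ih _ _ _ (by omega)

end DecisionTree

/-! ### The exponential potential of independent rounds -/

open DecisionTree

/-- The sign `1` of `true` and `-1` of `false`. -/
def boolSign (b : Bool) : ℝ := if b then 1 else -1

theorem boolSign_sq (b : Bool) : boolSign b ^ 2 = 1 := by cases b <;> simp [boolSign]

theorem sum_prod_eq_one {κ : Type} [Fintype κ] {p : κ → ℝ} (hp : p ∈ stdSimplex ℝ κ) (N : ℕ) :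
    ∑ r : Fin N → κ, ∏ i, p (r i) = 1 := by
  classical
  rw [← Fintype.piFinset_univ, Finset.sum_prod_piFinset]
  simp [hp.2]

theorem prod_mem_stdSimplex {κ : Type} [Fintype κ] {p : κ → ℝ} (hp : p ∈ stdSimplex ℝ κ)
    (N : ℕ) : (fun r : Fin N → κ => ∏ i, p (r i)) ∈ stdSimplex ℝ (Fin N → κ) :=
  ⟨fun _ => Finset.prod_nonneg fun _ _ => hp.1 _, sum_prod_eq_one hp N⟩

theorem sum_fin_succ_prod_mul {κ : Type} [Fintype κ] (p : κ → ℝ) (N : ℕ)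
    (F : (Fin (N + 1) → κ) → ℝ) :
    ∑ r : Fin (N + 1) → κ, (∏ i, p (r i)) * F r =
      ∑ a, p a * ∑ r : Fin N → κ, (∏ i, p (r i)) * F (Fin.cons a r) := by
  rw [← (Fin.consEquiv fun _ => κ).sum_comp, Fintype.sum_prod_type]
  refine Finset.sum_congr rfl fun a _ => ?_
  rw [Finset.mul_sum]
  refine Finset.sum_congr rfl fun r _ => ?_
  simp [Fin.consEquiv, Fin.prod_univ_succ, mul_assoc]

/-- At stopping time the potential dominates the error indicator: a wrong sign means `boolSign b * s
≤ 0`. The term `z` is `μ` times the overshoot of the budget. -/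
theorem ite_decide_pos_le_exp (b : Bool) {s z : ℝ} (hz : 0 ≤ z) :
    (if decide (0 < s) = b then (0 : ℝ) else 1) ≤ Real.exp (-(boolSign b * s) + z) := by
  by_cases h : decide (0 < s) = b
  · simp only [h, if_true]
    positivity
  · simp only [h, if_false]
    refine Real.one_le_exp ?_
    cases b
    · simp only [decide_eq_false_iff_not, not_lt, not_le] at h
      simp only [boolSign]
      norm_num
      linarith
    · simp only [decide_eq_true_eq, not_lt] at h
      simp only [boolSign]
      norm_num
      linarith

/-- The exponential supermartingale bound on the error of `rounds`. -/
theorem rounds_error_le {ι κ : Type} [Fintype κ] {p : κ → ℝ} (hp : p ∈ stdSimplex ℝ κ)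
    {T : κ → DecisionTree ι α ℝ} {B : ℕ} {h μ : ℝ} (hμ : 0 ≤ μ) {x : ι → α} {b : Bool}
    (hcost : ∀ r, 1 ≤ (T r).cost x)
    (hstep : ∑ r, p r *
      Real.exp (-(boolSign b * ((T r).eval x + h)) + μ * (T r).cost x) ≤ 1)
    (N : ℕ) (s : ℝ) (c : ℕ) (hN : B ≤ N + c) :
    ∑ r : Fin N → κ, (∏ i, p (r i)) *
        (if (rounds B h T N r s c).eval x = b then (0 : ℝ) else 1) ≤
      Real.exp (-(boolSign b * s) + μ * (c - B)) := by
  induction N generalizing s c with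
  | zero =>
    -- Every round costs at least one query, so running out of rounds also means that the budget is
    -- spent.
    have hc : (B : ℝ) ≤ c := by exact_mod_cast (by omega : B ≤ c)
    simpa [rounds, eval] using
      ite_decide_pos_le_exp b (s := s) (mul_nonneg hμ (sub_nonneg.2 hc))
  | succ N ih =>
    by_cases hB : B ≤ c
    · have hc : (B : ℝ) ≤ c := by exact_mod_cast hB
      simp only [rounds, hB, if_true, eval]
      rw [← Finset.sum_mul, sum_prod_eq_one hp, one_mul]
      exact ite_decide_pos_le_exp b (mul_nonneg hμ (sub_nonneg.2 hc))
    · rw [sum_fin_succ_prod_mul]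
      simp only [rounds, hB, if_false, eval_bindCost, Fin.cons_zero, Fin.tail_cons]
      calc _ ≤ ∑ a, p a * Real.exp (-(boolSign b * (s + (T a).eval x + h)) +
              μ * ((c + (T a).cost x : ℕ) - B)) :=
            Finset.sum_le_sum fun a _ => mul_le_mul_of_nonneg_left
              (ih _ _ (by have := hcost a; omega)) (hp.1 a)
        _ = Real.exp (-(boolSign b * s) + μ * (c - B)) * ∑ a, p a *
              Real.exp (-(boolSign b * ((T a).eval x + h)) + μ * (T a).cost x) := by
            rw [Finset.mul_sum]
            refine Finset.sum_congr rfl fun a _ => ?_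
            rw [mul_left_comm, ← Real.exp_add]
            congr 2
            push_cast
            ring
        _ ≤ _ := mul_le_of_le_one_right (Real.exp_nonneg _) hstep

theorem randomizedComputes_of_fintype [Fintype α] {κ : Type} [Fintype κ] {ε : ℝ}
    {f : PartialFun α n} {q : ℕ} (p : κ → ℝ) (hp : p ∈ stdSimplex ℝ κ)
    (T : κ → DecisionTree (Fin n) α Bool) (hT : ∀ r, (T r).depth ≤ q)
    (herr : ∀ x b, f x = some b → ∑ r, p r * (if (T r).eval x = b then (0 : ℝ) else 1) ≤ ε) :
    RandomizedComputes ε f q := by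
  classical
  let e := (Fintype.equivFin κ).symm
  refine ⟨Fintype.card κ, p ∘ e, T ∘ e, ⟨fun _ => hp.1 _, ?_⟩, fun r => hT _, fun x b hx => ?_⟩
  · rw [← hp.2]
    exact e.sum_comp p
  · have h1 := herr x b hx
    have h2 : ∑ r with ((T ∘ e) r).eval x = b, (p ∘ e) r =
        ∑ r, p r * (if (T r).eval x = b then 1 else 0) := by
      rw [Finset.sum_filter, ← e.sum_comp]
      simp
    have h3 : ∑ r, p r * (if (T r).eval x = b then (1 : ℝ) else 0) +
        ∑ r, p r * (if (T r).eval x = b then (0 : ℝ) else 1) = 1 := by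
      rw [← Finset.sum_add_distrib]
      refine (Finset.sum_congr rfl fun r _ => ?_).trans hp.2
      split_ifs <;> simp
    rw [h2]
    linarith

/-! ### Separation from the positive orthant -/

/-- Either the convex hull of `S` contains a vector with positive entries, or some probability
vector has nonpositive pairing with all of `S`. -/
theorem exists_pos_mem_convexHull_or_exists_stdSimplex {X : Type} [Fintype X]
    {S : Set (X → ℝ)} (hS : S.Nonempty) :
    (∃ v ∈ convexHull ℝ S, ∀ x, 0 < v x) ∨
      ∃ w ∈ stdSimplex ℝ X, ∀ v ∈ S, ∑ x, w x * v x ≤ 0 := by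
  classical
  by_cases hd : Disjoint (Set.univ.pi fun _ : X => Set.Ioi (0 : ℝ)) (convexHull ℝ S)
  · right
    obtain ⟨g, u, hg, hu⟩ := geometric_hahn_banach_open
      (convex_pi fun _ _ => convex_Ioi (0 : ℝ))
      (isOpen_set_pi Set.finite_univ fun _ _ => isOpen_Ioi) (convex_convexHull ℝ S) hd
    -- A functional bounded above on a cone is nonpositive there; `w` will be `-g`, normalized.
    have hgle : ∀ a : X → ℝ, (∀ x, 0 < a x) → g a ≤ 0 := by
      intro a ha
      by_contra! hpos
      have h1 := hg ((|u| / g a + 1) • a) fun x _ => by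
        have := ha x
        simp only [Pi.smul_apply, smul_eq_mul, Set.mem_Ioi]
        positivity
      rw [map_smul, smul_eq_mul, add_mul, div_mul_cancel₀ _ hpos.ne'] at h1
      linarith [le_abs_self u]
    have hu0 : 0 ≤ u := by
      by_contra! hneg
      let a : X → ℝ := fun _ => 1
      have h0 : g a ≤ 0 := hgle a fun _ => one_pos
      have h1 := hg ((|u| / (|g a| + 1)) • a) fun x _ => by
        have := abs_pos.2 hneg.ne
        simp only [Pi.smul_apply, smul_eq_mul, Set.mem_Ioi, a]
        positivity
      rw [map_smul, smul_eq_mul, abs_of_neg hneg, abs_of_nonpos h0, div_mul_eq_mul_div,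
        div_lt_iff₀ (by linarith)] at h1
      nlinarith
    have hrep : ∀ v : X → ℝ, g v = ∑ x, v x * g (Pi.single x 1) := by
      intro v
      conv_lhs => rw [pi_eq_sum_univ' v]
      simp [map_sum, Pi.single]
    have hnonpos : ∀ a : X → ℝ, (∀ x, 0 ≤ a x) → g a ≤ 0 := by
      intro a ha
      by_contra! hpos
      let e : X → ℝ := fun _ => 1
      have h1 := hgle (a + (g a / (2 * (|g e| + 1))) • e) fun x => by
        have := ha x
        simp only [Pi.add_apply, Pi.smul_apply, smul_eq_mul, e]
        positivity
      rw [map_add, map_smul, smul_eq_mul] at h1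
      have h2 : -(g a / (2 * (|g e| + 1)) * g e) ≤ g a / 2 := by
        rw [← mul_neg, div_mul_eq_mul_div, div_le_div_iff₀ (by positivity) two_pos]
        nlinarith [neg_abs_le (g e), abs_nonneg (g e)]
      linarith
    have hw : ∀ x, 0 ≤ -g (Pi.single x 1) := fun x => neg_nonneg.2 <| hnonpos _ fun y => by
      by_cases h : y = x
      · subst h; simp
      · simp [h]
    -- If `g` vanished, strictness on the open orthant would give `0 < u`, against `u ≤ 0` from `S`.
    have hW : 0 < ∑ x, -g (Pi.single x 1) := by
      refine lt_of_le_of_ne (Finset.sum_nonneg fun x _ => hw x) fun h0 => ?_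
      have hz : ∀ x, g (Pi.single x 1) = 0 := fun x => neg_eq_zero.1 <|
        (Finset.sum_eq_zero_iff_of_nonneg fun x _ => hw x).1 h0.symm x (Finset.mem_univ x)
      have hzero : ∀ v : X → ℝ, g v = 0 := fun v => by simp [hrep v, hz]
      obtain ⟨v, hv⟩ := hS
      have h1 := hu v (subset_convexHull ℝ S hv)
      have h2 := hg (fun _ => 1) fun _ _ => zero_lt_one' ℝ
      rw [hzero] at h1 h2
      linarith
    refine ⟨fun x => -g (Pi.single x 1) / ∑ y, -g (Pi.single y 1),
      ⟨fun x => div_nonneg (hw x) hW.le, ?_⟩, fun v hv => ?_⟩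
    · rw [← Finset.sum_div, div_self hW.ne']
    · have h1 := hu v (subset_convexHull ℝ S hv)
      have h2 : ∑ x, -g (Pi.single x 1) / (∑ y, -g (Pi.single y 1)) * v x =
          -g v / ∑ y, -g (Pi.single y 1) := by
        rw [hrep v, ← Finset.sum_neg_distrib, Finset.sum_div]
        exact Finset.sum_congr rfl fun x _ => by ring
      rw [h2]
      exact div_nonpos_of_nonpos_of_nonneg (by linarith) hW.le
  · left
    obtain ⟨v, hv, hv'⟩ := Set.not_disjoint_iff.1 hd
    exact ⟨v, hv', fun x => hv x (Set.mem_univ x)⟩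

/-! ### From positive gain to a randomized decision tree -/

/-- The value of `f` as a sign, and `0` outside of the domain. -/
def signValue (f : PartialFun α n) (x : Fin n → α) : ℝ := (f x).elim 0 boolSign

theorem signValue_of_eq_some {f : PartialFun α n} {x : Fin n → α} {b : Bool}
    (h : f x = some b) : signValue f x = boolSign b := by simp [signValue, h]

/-- The score of a tree with real labels on input `x`: correlation of the label with the value
of `f`, with penalties for large labels and for queries. -/
noncomputable def gain (μ : ℝ) (f : PartialFun α n) (T : DecisionTree (Fin n) α ℝ)
    (x : Fin n → α) : ℝ :=
  signValue f x * T.eval x - 4 * T.eval x ^ 2 - 2 * μ * T.cost x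

/-- One round of a mixture with nonnegative expected gain does not increase the exponential
potential. -/
theorem sum_mul_exp_le_one {κ : Type} [Fintype κ] {p y c : κ → ℝ} {b h μ : ℝ}
    (hp : p ∈ stdSimplex ℝ κ) (hb : b ^ 2 = 1) (hy : ∀ r, |y r| ≤ 1 / 24) (hh : |h| ≤ 1 / 24)
    (hμ : 0 ≤ μ) (hc : ∀ r, 0 ≤ c r) (hμc : ∀ r, μ * c r ≤ 1 / 10)
    (hgain : 0 ≤ ∑ r, p r * (b * (y r + h) - 4 * y r ^ 2 - 2 * μ * c r)) :
    ∑ r, p r * Real.exp (-(b * (y r + h)) + μ * c r) ≤ 1 := by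
  have hb1 : |b| = 1 := by rw [← Real.sqrt_sq_eq_abs, hb, Real.sqrt_one]
  have habs : ∀ r, |b * (y r + h)| ≤ 1 / 12 := by
    intro r
    rw [abs_mul, hb1, one_mul]
    linarith [abs_add_le (y r) h, hy r]
  have hexp : ∀ r, Real.exp (-(b * (y r + h)) + μ * c r) ≤
      1 + (-(b * (y r + h)) + μ * c r) + (-(b * (y r + h)) + μ * c r) ^ 2 := by
    intro r
    have h0 : 0 ≤ μ * c r := mul_nonneg hμ (hc r)
    have h1 := abs_le.1 (habs r)
    have h2 := Real.abs_exp_sub_one_sub_id_le (x := -(b * (y r + h)) + μ * c r)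
      (abs_le.2 ⟨by linarith [h1.2], by linarith [h1.1, hμc r]⟩)
    linarith [(abs_le.1 h2).2]
  -- From `(u + v)² ≤ 2u² + 2v²`. Since `gain` penalizes `y²` but not `h²`, `2(y + h)²` is rewritten
  -- so that `h²` has a negative coefficient and the cross term is linear in the drift `y + h`.
  have hsq : ∀ r, (-(b * (y r + h)) + μ * c r) ^ 2 ≤
      2 * y r ^ 2 + 4 * h * (y r + h) - 2 * h ^ 2 + 1 / 5 * (μ * c r) := by
    intro r
    have h0 : 0 ≤ μ * c r := mul_nonneg hμ (hc r)
    have h1 : (b * (y r + h)) ^ 2 = (y r + h) ^ 2 := by rw [mul_pow, hb, one_mul]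
    nlinarith [sq_nonneg (b * (y r + h) + μ * c r), mul_nonneg h0 (sub_nonneg.2 (hμc r))]
  set Y := ∑ r, p r * y r ^ 2
  set K := ∑ r, p r * (μ * c r)
  set m := ∑ r, p r * (y r + h)
  have hY : 0 ≤ Y := Finset.sum_nonneg fun r _ => mul_nonneg (hp.1 r) (sq_nonneg _)
  have hK : 0 ≤ K := Finset.sum_nonneg fun r _ =>
    mul_nonneg (hp.1 r) (mul_nonneg hμ (hc r))
  have hm : 4 * Y + 2 * K ≤ b * m := by
    have : ∑ r, p r * (b * (y r + h) - 4 * y r ^ 2 - 2 * μ * c r) = b * m - 4 * Y - 2 * K := by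
      simp only [m, Y, K, Finset.mul_sum, ← Finset.sum_sub_distrib]
      exact Finset.sum_congr rfl fun r _ => by ring
    linarith
  -- The cross term is a small fraction of the drift `b * m`, which `hm` makes nonnegative.
  have hhm : h * m ≤ 1 / 24 * (b * m) := by
    have h1 : h * m = (h * b) * (b * m) := by
      rw [show (h * b) * (b * m) = b ^ 2 * (h * m) by ring, hb, one_mul]
    rw [h1]
    refine mul_le_mul_of_nonneg_right ((le_abs_self _).trans ?_) (by linarith)
    rwa [abs_mul, hb1, mul_one]
  calc ∑ r, p r * Real.exp (-(b * (y r + h)) + μ * c r)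
      ≤ ∑ r, p r * (1 + (-(b * (y r + h)) + μ * c r) +
          (2 * y r ^ 2 + 4 * h * (y r + h) - 2 * h ^ 2 + 1 / 5 * (μ * c r))) :=
        Finset.sum_le_sum fun r _ => mul_le_mul_of_nonneg_left
          ((hexp r).trans (by linarith [hsq r])) (hp.1 r)
    _ = 1 - b * m + K + 2 * Y + 4 * (h * m) - 2 * h ^ 2 + 1 / 5 * K := by
        have h1 : (1 : ℝ) - 2 * h ^ 2 = ∑ r, p r * (1 - 2 * h ^ 2) := by
          rw [← Finset.sum_mul, hp.2, one_mul]
        have h2 : 1 - b * m + K + 2 * Y + 4 * (h * m) - 2 * h ^ 2 + 1 / 5 * K =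
          (1 - 2 * h ^ 2) - b * m + K + 2 * Y + (4 * h) * m + 1 / 5 * K := by ring
        rw [h2, h1]
        simp only [m, Y, K, Finset.mul_sum, ← Finset.sum_sub_distrib, ← Finset.sum_add_distrib]
        exact Finset.sum_congr rfl fun r _ => by ring
    _ ≤ 1 := by nlinarith [sq_nonneg h]

/-- A mixture of labelled trees with positive expected gain on every input of the domain, up to a
common shift `h` of the labels, yields a randomized decision tree for `f`. -/
theorem randomizedComputes_of_gain [Fintype α] {κ : Type} [Fintype κ] {f : PartialFun α n}
    {p : κ → ℝ} (hp : p ∈ stdSimplex ℝ κ) {T : κ → DecisionTree (Fin n) α ℝ} {q B : ℕ}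
    {h μ : ℝ} (hμ : 0 ≤ μ) (hμq : μ * q ≤ 1 / 10) (hB : 2 ≤ μ * B)
    (hT : ∀ r, (T r).depth ≤ q) (hlabel : ∀ r x, |(T r).eval x| ≤ 1 / 24)
    (hcost : ∀ r x, 1 ≤ (T r).cost x)
    {x₀ x₁ : Fin n → α} (hx₀ : f x₀ = some false) (hx₁ : f x₁ = some true)
    (hgain : ∀ x b, f x = some b → 0 ≤ ∑ r, p r * gain μ f (T r) x + h * boolSign b) :
    RandomizedComputes (1 / 3) f (B + q) := by
  have hgain' : ∀ x b, f x = some b → 0 ≤ ∑ r, p r *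
      (boolSign b * ((T r).eval x + h) - 4 * (T r).eval x ^ 2 - 2 * μ * (T r).cost x) := by
    intro x b hx
    convert hgain x b hx using 1
    have h1 : h * boolSign b = ∑ r, p r * (h * boolSign b) := by
      rw [← Finset.sum_mul, hp.2, one_mul]
    rw [h1, ← Finset.sum_add_distrib]
    refine Finset.sum_congr rfl fun r _ => ?_
    rw [gain, signValue_of_eq_some hx]
    ring
  have hμc : ∀ r x, μ * (T r).cost x ≤ 1 / 10 := fun r x =>
    (mul_le_mul_of_nonneg_left
      (by exact_mod_cast ((T r).cost_le_depth x).trans (hT r)) hμ).trans hμq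
  have hsum : ∀ x b, f x = some b → 0 ≤ boolSign b * (∑ r, p r * (T r).eval x + h) := by
    intro x b hx
    refine (hgain' x b hx).trans ?_
    have h1 : h = ∑ r, p r * h := by rw [← Finset.sum_mul, hp.2, one_mul]
    conv_rhs => rw [h1]
    rw [← Finset.sum_add_distrib, Finset.mul_sum]
    refine Finset.sum_le_sum fun r _ => ?_
    rw [← mul_add, mul_left_comm]
    refine mul_le_mul_of_nonneg_left ?_ (hp.1 r)
    have : 0 ≤ μ * (T r).cost x := mul_nonneg hμ (Nat.cast_nonneg _)
    nlinarith [sq_nonneg ((T r).eval x)]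
  have hmean : ∀ x, |∑ r, p r * (T r).eval x| ≤ 1 / 24 := by
    intro x
    calc |∑ r, p r * (T r).eval x| ≤ ∑ r, |p r * (T r).eval x| :=
          Finset.abs_sum_le_sum_abs _ _
      _ ≤ ∑ r, p r * (1 / 24) := Finset.sum_le_sum fun r _ => by
          rw [abs_mul, abs_of_nonneg (hp.1 r)]
          exact mul_le_mul_of_nonneg_left (hlabel r x) (hp.1 r)
      _ = 1 / 24 := by rw [← Finset.sum_mul, hp.2, one_mul]
  -- The shifted mean has the right sign at an input of each value, which bounds `h` from both
  -- sides.
  have hh : |h| ≤ 1 / 24 := by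
    have h0 := hsum x₀ false hx₀
    have h1 := hsum x₁ true hx₁
    simp only [boolSign] at h0 h1
    norm_num at h0 h1
    have h2 := abs_le.1 (hmean x₀)
    have h3 := abs_le.1 (hmean x₁)
    exact abs_le.2 ⟨by linarith [h3.2], by linarith [h2.1]⟩
  refine randomizedComputes_of_fintype _ (prod_mem_stdSimplex hp B)
    (fun r => rounds B h T B r 0 0) (fun r => ?_) fun x b hx => ?_
  · simpa using depth_rounds_add_le (B := B) (h := h) hT B r 0 0 (Nat.zero_le _)
  · refine (rounds_error_le hp hμ (fun r => hcost r x) ?_ B 0 0 (by simp)).trans ?_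
    · exact sum_mul_exp_le_one hp (boolSign_sq b) (fun r => hlabel r x) hh hμ
        (fun r => Nat.cast_nonneg _) (fun r => hμc r x) (hgain' x b hx)
    · have h1 : -(boolSign b * 0) + μ * (((0 : ℕ) : ℝ) - B) ≤ -2 := by
        push_cast
        linarith
      refine (Real.exp_le_exp.2 h1).trans ?_
      rw [Real.exp_neg, one_div]
      exact inv_anti₀ (by norm_num) (by linarith [Real.add_one_le_exp (2 : ℝ)])

/-! ### Hardness of selection from nonpositive gain -/

/-- Fubini: `G` does not see the `j`-th sample in its first argument, so that sample can be
integrated first. -/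
theorem sum_prod_mul_nonpos {X : Type} [Fintype X] {D : X → ℝ} (hD : ∀ x, 0 ≤ D x) {k : ℕ}
    (j : Fin k) (G : (Fin k → X) → X → ℝ)
    (hG : ∀ x y, (∀ i, i ≠ j → x i = y i) → G x = G y)
    (hle : ∀ x, ∑ z, D z * G x z ≤ 0) :
    ∑ x : Fin k → X, (∏ i, D (x i)) * G x (x j) ≤ 0 := by
  obtain _ | k := k
  · exact j.elim0
  rw [← (Fin.insertNthEquiv (fun _ => X) j).sum_comp, Fintype.sum_prod_type, Finset.sum_comm]
  refine Finset.sum_nonpos fun y _ => ?_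
  obtain hX | ⟨⟨z₀⟩⟩ := isEmpty_or_nonempty X
  · simp
  have h1 : ∀ z, G (j.insertNth z y) = G (j.insertNth (α := fun _ => X) z₀ y) := fun z =>
    hG _ _ fun i hi => by
      obtain ⟨l, rfl⟩ := Fin.exists_succAbove_eq hi
      simp
  calc _ = (∏ i, D (y i)) * ∑ z, D z * G (j.insertNth (α := fun _ => X) z₀ y) z := by
        rw [Finset.mul_sum]
        refine Finset.sum_congr rfl fun z _ => ?_
        simp only [Fin.insertNthEquiv, Equiv.coe_fn_mk, Fin.prod_univ_succAbove _ j,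
          Fin.insertNth_apply_same, Fin.insertNth_apply_succAbove, h1]
        ring
    _ ≤ 0 := mul_nonpos_of_nonneg_of_nonpos (Finset.prod_nonneg fun i _ => hD _) (hle _)

/-- If no labelled tree of depth at most `q` has positive expected gain under `D`, then
selection under `D` takes more than `q` queries. -/
theorem not_selectionSolvable_of_gain [Fintype α] {f : PartialFun α n} {D : (Fin n → α) → ℝ}
    (hD : IsInputDist f D) {μ : ℝ} {q : ℕ} (hμ : 0 ≤ μ) (hμq : 2 * μ * q < 1 / 144)
    (hgain : ∀ T : DecisionTree (Fin n) α ℝ, T.depth ≤ q → (∀ x, |T.eval x| ≤ 1 / 24) →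
      ∑ x, D x * gain μ f T x ≤ 0) (k : ℕ) :
    ¬ SelectionSolvable (1 / 3) k f D q := by
  classical
  rintro ⟨T, hT, hsucc⟩
  let L : Fin k → Fin k × Bool → ℝ := fun j o => if o.1 = j then boolSign o.2 / 24 else 0
  let R : Fin k → (Fin k → Fin n → α) → DecisionTree (Fin n) α ℝ :=
    fun j x => (T.restrict j x).relabel id (L j)
  have hL : ∀ j o, |L j o| ≤ 1 / 24 := by
    rintro j ⟨i, b⟩
    by_cases h : i = j <;> cases b <;> simp [L, h, boolSign, abs_div]
  have hcostR : ∀ (T : DecisionTree (Fin n) α (Fin k × Bool)) j x,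
      (T.relabel id (L j)).cost x = T.cost x := by
    intro T j x
    induction T with
    | leaf b => rfl
    | query i next ih => simp [relabel, cost, ih]
  have h1 : ∀ j, ∑ x : Fin k → Fin n → α, (∏ i, D (x i)) * gain μ f (R j x) (x j) ≤ 0 := by
    intro j
    refine sum_prod_mul_nonpos hD.1.1 j (fun x => gain μ f (R j x)) (fun x y h => ?_) fun x => ?_
    · simp only [R, restrict_congr j x y h]
    · refine hgain _ ?_ fun z => ?_
      · rw [depth_relabel]
        exact (depth_restrict_le j x T).trans hT
      · rw [eval_relabel]
        exact hL _ _
  let o : (Fin k → Fin n → α) → Fin k × Bool := fun x => T.eval fun c => x c.1 c.2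
  have h2 : ∀ x : Fin k → Fin n → α, ∑ j, gain μ f (R j x) (x j) =
      signValue f (x (o x).1) * boolSign (o x).2 / 24 - 1 / 144 -
        2 * μ * T.cost fun c => x c.1 c.2 := by
    intro x
    rw [← sum_cost_restrict x T]
    have he : ∀ j, (R j x).eval (x j) = L j (o x) := by
      intro j
      simp only [R, eval_relabel, Function.comp_id, eval_restrict, o]
    simp only [gain, he, Finset.sum_sub_distrib, R, hcostR, ← Finset.mul_sum, Nat.cast_sum]
    -- Only the selected sample pays the quadratic penalty, `4 / 576 = 1 / 144` in total whatever
    -- `k` is.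
    have h3 : ∀ j, L j (o x) ^ 2 = if (o x).1 = j then 1 / 576 else 0 := by
      intro j
      by_cases h : (o x).1 = j
      · simp only [L, h, if_true, div_pow, boolSign_sq]
        norm_num
      · simp [L, h]
    simp only [h3]
    simp only [L, mul_ite, mul_zero, Finset.sum_ite_eq, Finset.mem_univ, if_true]
    ring
  have h4 : ∑ x : Fin k → Fin n → α, (∏ i, D (x i)) * ∑ j, gain μ f (R j x) (x j) ≤ 0 := by
    simp only [Finset.mul_sum]
    rw [Finset.sum_comm]
    exact Finset.sum_nonpos fun j _ => h1 j
  have h5 : ∀ x : Fin k → Fin n → α,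
      (∏ i, D (x i)) * ((2 * (if f (x (o x).1) = some (o x).2 then 1 else 0) - 1) / 24 -
        1 / 144 - 2 * μ * q) ≤ (∏ i, D (x i)) * ∑ j, gain μ f (R j x) (x j) := by
    intro x
    by_cases h0 : ∏ i, D (x i) = 0
    · simp [h0]
    refine mul_le_mul_of_nonneg_left ?_ (Finset.prod_nonneg fun i _ => hD.1.1 _)
    rw [h2]
    have h6 : μ * (T.cost fun c => x c.1 c.2) ≤ μ * q := mul_le_mul_of_nonneg_left
      (by exact_mod_cast (T.cost_le_depth _).trans hT) hμ
    have h7 : (2 * (if f (x (o x).1) = some (o x).2 then 1 else 0) - 1 : ℝ) ≤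
        signValue f (x (o x).1) * boolSign (o x).2 := by
      have hne : D (x (o x).1) ≠ 0 := Finset.prod_ne_zero_iff.1 h0 _ (Finset.mem_univ _)
      cases hf : f (x (o x).1) with
      | none => exact (hne (hD.2 _ hf)).elim
      | some b =>
        rw [signValue_of_eq_some hf]
        generalize (o x).2 = b'
        cases b <;> cases b' <;> norm_num [boolSign]
    linarith
  have h8 := (Finset.sum_le_sum fun x (_ : x ∈ Finset.univ) => h5 x).trans h4
  have h9 : ∑ x : Fin k → Fin n → α, (∏ i, D (x i)) *
      ((2 * (if f (x (o x).1) = some (o x).2 then 1 else 0) - 1) / 24 - 1 / 144 - 2 * μ * q) =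
      selectionSuccess f D T / 12 - 1 / 24 - 1 / 144 - 2 * μ * q := by
    have hs : selectionSuccess f D T = ∑ x : Fin k → Fin n → α, (∏ i, D (x i)) *
        (if f (x (o x).1) = some (o x).2 then 1 else 0) := by
      simp only [selectionSuccess, Finset.sum_filter, mul_ite, mul_one, mul_zero, o]
    have hone : (1 / 24 + 1 / 144 + 2 * μ * q : ℝ) = ∑ x : Fin k → Fin n → α, (∏ i, D (x i)) *
        (1 / 24 + 1 / 144 + 2 * μ * q) := by
      rw [← Finset.sum_mul, sum_prod_eq_one hD.1, one_mul]
    have : selectionSuccess f D T / 12 - 1 / 24 - 1 / 144 - 2 * μ * q =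
      selectionSuccess f D T / 12 - (1 / 24 + 1 / 144 + 2 * μ * q) := by ring
    rw [this, hone, hs, Finset.sum_div, ← Finset.sum_sub_distrib]
    exact Finset.sum_congr rfl fun x _ => by ring
  -- Success at least `2/3` makes the left side at least `1/18 - 1/24 - 1/144 - 2μq = 1/144 - 2μq >
  -- 0`.
  rw [h9] at h8
  linarith

/-! ### Balanced distributions and the minimax alternative -/

theorem sum_signValue_eq_zero [Fintype α] {f : PartialFun α n} {D : (Fin n → α) → ℝ}
    (hD : IsBalancedDist f D) : ∑ x, D x * signValue f x = 0 := by
  classical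
  have h0 := hD.2 false
  have h1 := hD.2 true
  have : ∑ x, D x * signValue f x =
      ∑ x with f x = some true, D x - ∑ x with f x = some false, D x := by
    rw [Finset.sum_filter, Finset.sum_filter, ← Finset.sum_sub_distrib]
    refine Finset.sum_congr rfl fun x _ => ?_
    rcases hf : f x with _ | _ | _ <;> simp [signValue, hf, boolSign]
  rw [this, h0, h1, sub_self]

theorem isBalancedDist_of_sum_signValue [Fintype α] {f : PartialFun α n}
    {D : (Fin n → α) → ℝ} (hD : IsInputDist f D) (h : ∑ x, D x * signValue f x = 0) :
    IsBalancedDist f D := by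
  classical
  refine ⟨hD, ?_⟩
  have hsub : ∑ x, D x * signValue f x =
      ∑ x with f x = some true, D x - ∑ x with f x = some false, D x := by
    rw [Finset.sum_filter, Finset.sum_filter, ← Finset.sum_sub_distrib]
    refine Finset.sum_congr rfl fun x _ => ?_
    rcases hf : f x with _ | _ | _ <;> simp [signValue, hf, boolSign]
  have hadd : ∑ x, D x =
      ∑ x with f x = some true, D x + ∑ x with f x = some false, D x := by
    rw [Finset.sum_filter, Finset.sum_filter, ← Finset.sum_add_distrib]
    refine Finset.sum_congr rfl fun x _ => ?_
    rcases hf : f x with _ | _ | _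
    · simp [hD.2 x hf]
    · simp
    · simp
  rw [h] at hsub
  rw [hD.1.2] at hadd
  rintro (_ | _) <;> linarith

theorem sum_gain_leaf_nonpos [Fintype α] {f : PartialFun α n} {D : (Fin n → α) → ℝ}
    (hD : IsBalancedDist f D) (μ y : ℝ) : ∑ x, D x * gain μ f (leaf y) x ≤ 0 := by
  have : ∑ x, D x * gain μ f (leaf y) x =
      y * ∑ x, D x * signValue f x - 4 * y ^ 2 * ∑ x, D x := by
    rw [Finset.mul_sum, Finset.mul_sum, ← Finset.sum_sub_distrib]
    refine Finset.sum_congr rfl fun x _ => ?_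
    simp only [gain, eval, cost]
    push_cast
    ring
  rw [this, sum_signValue_eq_zero hD, hD.1.1.2]
  nlinarith [sq_nonneg y]

theorem exists_isBalancedDist [Fintype α] {f : PartialFun α n} {x₀ x₁ : Fin n → α}
    (hx₀ : f x₀ = some false) (hx₁ : f x₁ = some true) : ∃ D, IsBalancedDist f D := by
  classical
  refine ⟨fun x => (if x = x₀ then 1 / 2 else 0) + (if x = x₁ then 1 / 2 else 0),
    isBalancedDist_of_sum_signValue ⟨⟨fun x => by positivity, ?_⟩, fun x hx => ?_⟩ ?_⟩
  · rw [Finset.sum_add_distrib]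
    norm_num
  · have h0 : x ≠ x₀ := by rintro rfl; simp [hx₀] at hx
    have h1 : x ≠ x₁ := by rintro rfl; simp [hx₁] at hx
    simp [h0, h1]
  · simp [add_mul, Finset.sum_add_distrib, signValue_of_eq_some hx₀, signValue_of_eq_some hx₁,
      boolSign]

/-- Either `f` has a fast randomized decision tree, or there is a balanced distribution under
which no shallow labelled tree has positive expected gain. -/
theorem randomizedComputes_or_exists_isBalancedDist [Fintype α] {f : PartialFun α n}
    {x₀ x₁ : Fin n → α} (hx₀ : f x₀ = some false) (hx₁ : f x₁ = some true) {q B : ℕ} {μ : ℝ}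
    (hq : 1 ≤ q) (hμ : 0 ≤ μ) (hμq : μ * q ≤ 1 / 10) (hB : 2 ≤ μ * B) :
    RandomizedComputes (1 / 3) f (B + q) ∨
      ∃ D, IsBalancedDist f D ∧ ∀ T : DecisionTree (Fin n) α ℝ, T.depth ≤ q →
        (∀ x, |T.eval x| ≤ 1 / 24) → ∑ x, D x * gain μ f T x ≤ 0 := by
  classical
  let X := {x : Fin n → α // f x ≠ none}
  let P : DecisionTree (Fin n) α ℝ → Prop := fun T =>
    T.depth ≤ q ∧ (∀ x, |T.eval x| ≤ 1 / 24) ∧ ∀ x, 1 ≤ T.cost x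
  -- `P` demands at least one query so that `B` rounds exhaust the budget. The free multiple `h` of
  -- the sign vector forces the dual distribution to be balanced.
  let S : Set (X → ℝ) := {v | ∃ T h, P T ∧ v = fun x => gain μ f T x.1 + h * signValue f x.1}
  have hn : 0 < n := by
    rcases Nat.eq_zero_or_pos n with rfl | h
    · rw [Subsingleton.elim x₀ x₁, hx₁] at hx₀
      simp at hx₀
    · exact h
  have hS : S.Nonempty := by
    refine ⟨_, query ⟨0, hn⟩ fun _ => leaf 0, 0, ⟨?_, fun x => ?_, fun x => ?_⟩, rfl⟩
    · have : (Finset.univ.sup fun _ : α => 0) = 0 := by simp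
      simp only [depth]
      omega
    · simp [eval]
    · simp [cost]
  rcases exists_pos_mem_convexHull_or_exists_stdSimplex hS with ⟨v, hv, hpos⟩ | ⟨w, hw, hle⟩
  · left
    obtain ⟨κ, _, p, z, hp0, hp1, hz, hpz⟩ := mem_convexHull_iff_exists_fintype.1 hv
    choose T h hT hzT using hz
    refine randomizedComputes_of_gain (h := ∑ r, p r * h r) ⟨hp0, hp1⟩ hμ hμq hB
      (fun r => (hT r).1) (fun r => (hT r).2.1) (fun r => (hT r).2.2) hx₀ hx₁ fun x b hx => ?_
    have h1 := (hpos ⟨x, by simp [hx]⟩).le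
    rw [← hpz] at h1
    refine h1.trans_eq ?_
    simp only [Finset.sum_apply, Pi.smul_apply, smul_eq_mul, hzT, signValue_of_eq_some hx]
    rw [Finset.sum_mul, ← Finset.sum_add_distrib]
    exact Finset.sum_congr rfl fun r _ => by ring
  · right
    let D : (Fin n → α) → ℝ := fun x => if h : f x ≠ none then w ⟨x, h⟩ else 0
    have hsum : ∀ F : (Fin n → α) → ℝ, ∑ x, D x * F x = ∑ x : X, w x * F x.1 := by
      intro F
      have h1 : ∑ x with f x ≠ none, D x * F x = ∑ x, D x * F x := by
        refine Finset.sum_filter_of_ne fun x _ hx => ?_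
        by_contra hf
        simp [D, hf] at hx
      rw [← h1, Finset.sum_subtype (p := fun x => f x ≠ none) _ (by simp)]
      refine Finset.sum_congr rfl fun x _ => ?_
      simp [D, x.2]
    have hD : IsInputDist f D := by
      refine ⟨⟨fun x => ?_, ?_⟩, fun x hx => by simp [D, hx]⟩
      · simp only [D]
        split_ifs
        · exact hw.1 _
        · exact le_rfl
      · simpa [hw.2] using hsum fun _ => 1
    have hle' : ∀ T h, P T →
        ∑ x, D x * gain μ f T x + h * ∑ x, D x * signValue f x ≤ 0 := by
      intro T h hT
      refine le_trans (le_of_eq ?_) (hle _ ⟨T, h, hT, rfl⟩)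
      rw [hsum, hsum, Finset.mul_sum, ← Finset.sum_add_distrib]
      exact Finset.sum_congr rfl fun r _ => by ring
    -- An affine function of `h` that is never positive has slope zero.
    have hbal : ∑ x, D x * signValue f x = 0 := by
      obtain ⟨_, T, _, hT, -⟩ := hS
      by_contra hne
      have := hle' T ((1 - ∑ x, D x * gain μ f T x) / ∑ x, D x * signValue f x) hT
      rw [div_mul_cancel₀ _ hne] at this
      linarith
    have hD' := isBalancedDist_of_sum_signValue hD hbal
    refine ⟨D, hD', fun T hT hlabel => ?_⟩
    -- Leaves make no query and so are not covered by `P`; for them balance alone gives the bound.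
    cases T with
    | leaf y => exact sum_gain_leaf_nonpos hD' μ y
    | query i next =>
      simpa [hbal] using hle' _ 0 ⟨hT, hlabel, fun x => by simp [cost]⟩

/-! ### Comparison of the complexity measures -/

theorem exists_selectionSolvable_selDist [Fintype α] {ε : ℝ} (hε : 0 ≤ ε) {f : PartialFun α n}
    {D : (Fin n → α) → ℝ} (hD : IsInputDist f D) :
    ∃ k, SelectionSolvable ε k f D (selDist ε f D) := by
  obtain ⟨k, hk, h⟩ := Nat.sInf_mem
    (s := {q | ∃ k, 1 ≤ k ∧ kSel ε k f D = q}) ⟨_, 1, le_rfl, rfl⟩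
  refine ⟨k, ?_⟩
  rw [selDist, ← h]
  exact Nat.sInf_mem (s := {q | SelectionSolvable ε k f D q})
    ⟨n, selectionSolvable_self hε hk hD⟩

theorem SelectionSolvable.mono [Fintype α] {ε : ℝ} {k : ℕ} {f : PartialFun α n}
    {D : (Fin n → α) → ℝ} {q q' : ℕ} (hq : q ≤ q') (h : SelectionSolvable ε k f D q) :
    SelectionSolvable ε k f D q' :=
  let ⟨T, hT, hs⟩ := h
  ⟨T, hT.trans hq, hs⟩

theorem exists_selectionSolvable_selBalanced [Fintype α] {ε : ℝ} (hε : 0 ≤ ε)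
    {f : PartialFun α n} {D : (Fin n → α) → ℝ} (hD : IsBalancedDist f D) :
    ∃ k, SelectionSolvable ε k f D (selBalanced ε f) :=
  let ⟨k, hk⟩ := exists_selectionSolvable_selDist hε hD.1
  ⟨k, hk.mono (le_csSup (bddAbove_selBalanced hε f) ⟨D, hD, rfl⟩)⟩

theorem randQuery_eq_zero_of_forall_ne [Fintype α] {f : PartialFun α n} (b : Bool)
    (h : ∀ x, f x ≠ some b) {ε : ℝ} (hε : 0 ≤ ε) : randQuery ε f = 0 := by
  refine Nat.le_zero.1 (Nat.sInf_le ⟨1, fun _ => 1, fun _ => leaf !b, ⟨by simp, by simp⟩,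
    fun _ => le_rfl, fun x b' hx => ?_⟩)
  have : (!b) = b' := by
    have hne : b' ≠ b := by rintro rfl; exact h x hx
    cases b <;> cases b' <;> simp_all
  simp [eval, this, hε]

theorem randQuery_le_selBalanced [Fintype α] (f : PartialFun α n) :
    randQuery (1 / 3) f ≤ 601 * selBalanced (1 / 3) f := by
  by_cases h₀ : ∃ x, f x = some false
  swap
  · push Not at h₀
    rw [randQuery_eq_zero_of_forall_ne false h₀ (by norm_num)]
    exact Nat.zero_le _
  by_cases h₁ : ∃ x, f x = some true
  swap
  · push Not at h₁
    rw [randQuery_eq_zero_of_forall_ne true h₁ (by norm_num)]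
    exact Nat.zero_le _
  obtain ⟨x₀, hx₀⟩ := h₀
  obtain ⟨x₁, hx₁⟩ := h₁
  set q := selBalanced (1 / 3) f with hqdef
  -- For `q = 0` every tree is a leaf, and leaves have nonpositive gain under any balanced
  -- distribution, so selection without queries is impossible.
  rcases Nat.eq_zero_or_pos q with hq | hq
  · exfalso
    obtain ⟨D, hD⟩ := exists_isBalancedDist hx₀ hx₁
    obtain ⟨k, hk⟩ := exists_selectionSolvable_selBalanced (by norm_num : (0 : ℝ) ≤ 1 / 3) hD
    rw [← hqdef, hq] at hk
    refine not_selectionSolvable_of_gain hD.1 (μ := 0) le_rfl (by norm_num)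
      (fun T hT _ => ?_) k hk
    cases T with
    | leaf y => exact sum_gain_leaf_nonpos hD 0 y
    | query i next => simp [depth] at hT
  · have hq' : (0 : ℝ) < q := by exact_mod_cast hq
    have hμq : 1 / (300 * (q : ℝ)) * q = 1 / 300 := by field_simp
    -- With `μ = 1 / (300 q)`, `2μq = 1/150` is just below `1/144`, and `B = 600 q` gives `μB = 2`.
    rcases randomizedComputes_or_exists_isBalancedDist hx₀ hx₁ (B := 600 * q)
      (μ := 1 / (300 * (q : ℝ))) hq (by positivity) (by rw [hμq]; norm_num)
      (by push_cast; linarith) with h | ⟨D, hD, hgain⟩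
    · exact (Nat.sInf_le h).trans (by omega)
    · obtain ⟨k, hk⟩ := exists_selectionSolvable_selBalanced (by norm_num : (0 : ℝ) ≤ 1 / 3) hD
      exact (not_selectionSolvable_of_gain hD.1 (by positivity)
        (by rw [mul_assoc, hμq]; norm_num) hgain k hk).elim

theorem selectionSolvable_one_of_randomizedComputes [Fintype α] {ε : ℝ} {f : PartialFun α n}
    {D : (Fin n → α) → ℝ} (hD : IsInputDist f D) {q : ℕ} (h : RandomizedComputes ε f q) :
    SelectionSolvable ε 1 f D q := by
  classical
  obtain ⟨m, p, T, hp, hT, hsucc⟩ := h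
  let A : Fin m → ℝ := fun r => ∑ x, D x * (if f x = some ((T r).eval x) then 1 else 0)
  have havg : 1 - ε ≤ ∑ r, p r * A r := by
    calc 1 - ε = ∑ x, D x * (1 - ε) := by rw [← Finset.sum_mul, hD.1.2, one_mul]
      _ ≤ ∑ x, D x * ∑ r, p r * (if f x = some ((T r).eval x) then 1 else 0) := by
        refine Finset.sum_le_sum fun x _ => ?_
        cases hf : f x with
        | none => simp [hD.2 x hf]
        | some b =>
          refine mul_le_mul_of_nonneg_left ((hsucc x b hf).trans (le_of_eq ?_)) (hD.1.1 x)
          rw [Finset.sum_filter]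
          simp [eq_comm]
      _ = ∑ r, p r * A r := by
        simp only [A, Finset.mul_sum]
        rw [Finset.sum_comm]
        exact Finset.sum_congr rfl fun r _ => Finset.sum_congr rfl fun x _ => by ring
  obtain ⟨r, hr⟩ : ∃ r, 1 - ε ≤ A r := by
    by_contra! hlt
    have h1 : ∑ r, p r * A r < ∑ r, p r * (1 - ε) := by
      -- Strict inequality of the averages needs an index of positive weight.
      obtain ⟨r, -, hr⟩ := Finset.exists_ne_zero_of_sum_ne_zero (hp.2 ▸ one_ne_zero)
      exact Finset.sum_lt_sum (fun r _ => mul_le_mul_of_nonneg_left (hlt r).le (hp.1 r))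
        ⟨r, Finset.mem_univ r, mul_lt_mul_of_pos_left (hlt r) ((hp.1 r).lt_of_ne' hr)⟩
    rw [← Finset.sum_mul, hp.2, one_mul] at h1
    linarith
  refine ⟨(T r).relabel (fun l => (0, l)) fun b => (0, b), by rw [depth_relabel]; exact hT r, ?_⟩
  refine hr.trans (le_of_eq ?_)
  simp only [selectionSuccess, eval_relabel, Finset.sum_filter, A]
  rw [← (Equiv.funUnique (Fin 1) (Fin n → α)).symm.sum_comp]
  refine Finset.sum_congr rfl fun x _ => ?_
  simp [Function.comp_def]

theorem sel_le_randQuery [Fintype α] {ε : ℝ} (hε : 0 ≤ ε) (f : PartialFun α n) :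
    sel ε f ≤ randQuery ε f := by
  refine csSup_le' ?_
  rintro q ⟨D, hD, rfl⟩
  have h : RandomizedComputes ε f (randQuery ε f) :=
    Nat.sInf_mem (s := {q | RandomizedComputes ε f q}) ⟨n, randomizedComputes_self hε f⟩
  calc selDist ε f D ≤ kSel ε 1 f D := Nat.sInf_le ⟨1, le_rfl, rfl⟩
    _ ≤ randQuery ε f := Nat.sInf_le (selectionSolvable_one_of_randomizedComputes hD h)

theorem selBalanced_le_sel [Fintype α] {ε : ℝ} (hε : 0 ≤ ε) (f : PartialFun α n) :
    selBalanced ε f ≤ sel ε f := by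
  refine csSup_le' ?_
  rintro q ⟨D, hD, rfl⟩
  exact le_csSup (bddAbove_sel hε f) ⟨D, hD.1, rfl⟩

end QueryComplexity

theorem mainTheorem5 :
    ∃ c C : ℝ, 0 < c ∧ 0 < C ∧
      ∀ (α : Type) [Fintype α] (n : ℕ) (f : QueryComplexity.PartialFun α n),
        (c * (QueryComplexity.randQuery (1 / 3) f : ℝ) ≤ (QueryComplexity.sel (1 / 3) f : ℝ) ∧
          (QueryComplexity.sel (1 / 3) f : ℝ) ≤ C * (QueryComplexity.randQuery (1 / 3) f : ℝ)) ∧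
        (c * (QueryComplexity.randQuery (1 / 3) f : ℝ) ≤
            (QueryComplexity.selBalanced (1 / 3) f : ℝ) ∧
          (QueryComplexity.selBalanced (1 / 3) f : ℝ) ≤
            C * (QueryComplexity.randQuery (1 / 3) f : ℝ)) := by
  refine ⟨1 / 601, 1, by norm_num, one_pos, fun α _ n f => ?_⟩
  have h3 : (0 : ℝ) ≤ 1 / 3 := by norm_num
  have h1 : (QueryComplexity.randQuery (1 / 3) f : ℝ) ≤
      601 * (QueryComplexity.selBalanced (1 / 3) f : ℝ) := by
    exact_mod_cast QueryComplexity.randQuery_le_selBalanced f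
  have h2 : (QueryComplexity.selBalanced (1 / 3) f : ℝ) ≤ QueryComplexity.sel (1 / 3) f := by
    exact_mod_cast QueryComplexity.selBalanced_le_sel h3 f
  have h4 : (QueryComplexity.sel (1 / 3) f : ℝ) ≤ QueryComplexity.randQuery (1 / 3) f := by
    exact_mod_cast QueryComplexity.sel_le_randQuery h3 f
  refine ⟨⟨?_, ?_⟩, ?_, ?_⟩ <;> linarith
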